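/- Let $S^3=\{x\in\mathbb{R}^4:\|x\|=1\}$ be the unit sphere with its standard (round) Riemannian metric $\langle\cdot,\cdot\rangle$ induced from $\mathbb{R}^4$, let $\nabla$ be the gradient, $\Delta=\operatorname{div}\nabla$ the Laplace--Beltrami operator and $\mu$ the Riemannian volume measure of $S^3$, and let $$P\varphi=\Delta^2\varphi+\tfrac12\Delta\varphi-\tfrac{15}{16}\varphi$$ be the Paneitz operator of $S^3$. Let $x_1,\dots,x_4$ denote the coordinate functions of $\mathbb{R}^4$ restricted to $S^3$. If $\chi$ and $\rho$ are positive smooth functions on $S^3$ such that $$P\rho=-\chi\rho^{-7}\quad\text{on }S^3,$$ then $$\int_{S^3}\langle\nabla\chi(x),\nabla x_i\rangle\,\rho(x)^{-6}\,d\mu(x)=0\qquad\text{for } i=1,2,3,4.$$ -/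

import Mathlib

open scoped Manifold ContDiff RealInnerProductSpace

noncomputable section

namespace PaneitzSphere

/-- The Euclidean space `ℝ⁴`. -/
abbrev R4 : Type := EuclideanSpace ℝ (Fin 4)

/-- The unit sphere `S³ ⊂ ℝ⁴`, with Mathlib's smooth structure. -/
abbrev S3 : Type := Metric.sphere (0 : R4) 1

instance finrank_R4 : Fact (Module.finrank ℝ R4 = 3 + 1) := ⟨by simp⟩

/-- The tangent space of `S³` at `x`, realized as the hyperplane `x^⊥` of `ℝ⁴`. It carries the
inner product of `ℝ⁴`; this is the standard (round) metric of `S³`. -/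
abbrev TanPlane (x : S3) : Submodule ℝ R4 := (Submodule.span ℝ {(x : R4)})ᗮ

/-- The differential of the inclusion identifies the abstract tangent space `T_x S³` with the
hyperplane `x^⊥`. -/
def tanEquiv (x : S3) : TangentSpace (𝓡 3) x ≃ₗ[ℝ] TanPlane x :=
  (LinearEquiv.ofInjective (mvfderiv (𝓡 3) (Subtype.val : S3 → R4) x).toLinearMap
    (injective_mvfderiv_subtypeVal_sphere x)).trans
  (LinearEquiv.ofEq _ _ (range_mvfderiv_subtypeVal x))

/-- The differential at `x` of a map `f : S³ → V` into a normed space, as a linear map on the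
hyperplane `x^⊥`. -/
def tanDeriv {V : Type*} [NormedAddCommGroup V] [NormedSpace ℝ V] (f : S3 → V) (x : S3) :
    TanPlane x →ₗ[ℝ] V :=
  (mvfderiv (𝓡 3) f x).toLinearMap ∘ₗ (tanEquiv x).symm.toLinearMap

/-- The gradient of `f` at `x` for the round metric: the Riesz dual of the differential,
`⟨∇f, w⟩ = df(w)` for all tangent vectors `w`. -/
def grad (f : S3 → ℝ) (x : S3) : TanPlane x :=
  (InnerProductSpace.toDual ℝ (TanPlane x)).symm (LinearMap.toContinuousLinearMap (tanDeriv f x))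

/-- The covariant derivative of a tangent vector field `X` on `S³` at `x`, as the endomorphism
`w ↦ ∇_w X` of the tangent space. The Levi-Civita connection of the metric induced from `ℝ⁴` is
the tangential part of the derivative of `X` as an `ℝ⁴`-valued map. -/
def covDeriv (X : ∀ x : S3, TanPlane x) (x : S3) : TanPlane x →ₗ[ℝ] TanPlane x :=
  (TanPlane x).orthogonalProjectionOnto.toLinearMap ∘ₗ tanDeriv (fun y => (X y : R4)) x

/-- The divergence of a tangent vector field: the trace of its covariant derivative. -/
def divergence (X : ∀ x : S3, TanPlane x) (x : S3) : ℝ :=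
  LinearMap.trace ℝ (TanPlane x) (covDeriv X x)

/-- The Laplace-Beltrami operator `Δ = div ∇` of the round `S³`. -/
def laplacian (f : S3 → ℝ) (x : S3) : ℝ := divergence (grad f) x

/-- The Paneitz operator `P = Δ² + (1/2) Δ - 15/16` of the round `S³`. -/
def paneitz (f : S3 → ℝ) (x : S3) : ℝ :=
  laplacian (laplacian f) x + 1 / 2 * laplacian f x - 15 / 16 * f x

/-- The `i`-th coordinate function of `ℝ⁴` restricted to `S³`. -/
def coord (i : Fin 4) (x : S3) : ℝ := (x : R4) i

/-- The surface (Riemannian volume) measure of `S³`, of total mass `4 · |B⁴| = 2π²`. -/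
def surfaceMeasure : MeasureTheory.Measure S3 :=
  (MeasureTheory.volume : MeasureTheory.Measure R4).toSphere

end PaneitzSphere

end

/-!
Identify `S³` with the group of unit quaternions. Its left-invariant orthonormal frame
`E₀, E₁, E₂` consists of derivations of `C^∞(S³)` with `[Eₐ, Eₐ₊₁] = 2 Eₐ₊₂` and `∫ Eₐ f = 0`, so
that `Δ = ∑ₐ Eₐ²`. For the restriction `u` of a linear function one computes in this frame that the
operators `T_w f = ⟨∇u, ∇f⟩ + w u f` satisfy
`(Δ + w² - 1) T_w = T_{w-2} (Δ + (w+1)² - 1)`.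
Since `P = (Δ + 5/4)(Δ - 3/4)`, the cases `w = 1/2` and `w = -3/2` give
`P T_{1/2} = T_{-7/2} P`. As `Δu = -3u`, the adjoint of `T_v` is `-T_{-3-v}`. Thus `P T_{1/2}` is
skew, `P` being symmetric, and `∫ (T_{1/2} ρ) Pρ = 0` for every `ρ`. Inserting `Pρ = -χ ρ⁻⁷` and
`T_{-3} (ρ⁻⁶) = -6 ρ⁻⁷ T_{1/2} ρ`, an integration by parts (`T_0` and `-T_{-3}` are adjoint) turns
this into the claim.
-/

noncomputable section

namespace PaneitzSphere

section Frame

variable {R A M ι : Type*} [CommRing R] [CommRing A] [Algebra R A] [AddCommGroup M] [Module R M]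
  [Fintype ι]

/-- The gradient field `∇u = ∑ₐ (Eₐ u) Eₐ` of `u` with respect to a frame of vector fields
(derivations) that is declared orthonormal; as a derivation, `∇u f = ⟨∇u, ∇f⟩`. -/
def frameGrad (E : ι → Derivation R A A) (u : A) : Derivation R A A :=
  ∑ a, E a u • E a

/-- The sum of squares `∑ₐ Eₐ²` of a frame; it is the Laplacian when the fields of the orthonormal
frame are divergence-free. -/
def frameLaplacian (E : ι → Derivation R A A) : Module.End R A :=
  ∑ a, (E a : Module.End R A) ^ 2

/-- The operator `f ↦ ⟨∇u, ∇f⟩ + w u f`: the infinitesimal action of the field `∇u` on densities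
of conformal weight `w`. -/
def conformalDeriv (E : ι → Derivation R A A) (u : A) (w : R) : Module.End R A :=
  (frameGrad E u : Module.End R A) + w • LinearMap.mulLeft R u

variable {E : ι → Derivation R A A}

theorem frameGrad_apply (u f : A) : frameGrad E u f = ∑ a, E a u * E a f := by
  rw [frameGrad, ← Derivation.coeFnAddMonoidHom_apply, map_sum, Finset.sum_apply]
  rfl

theorem frameGrad_comm (u f : A) : frameGrad E u f = frameGrad E f u := by
  simp only [frameGrad_apply, mul_comm]

theorem frameLaplacian_apply (f : A) : frameLaplacian E f = ∑ a, E a (E a f) := by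
  simp [frameLaplacian, LinearMap.sum_apply, sq]

theorem conformalDeriv_apply (u f : A) (w : R) :
    conformalDeriv E u w f = frameGrad E u f + w • (u * f) := rfl

theorem frameLaplacian_mul (f g : A) :
    frameLaplacian E (f * g) =
      frameLaplacian E f * g + 2 * frameGrad E f g + f * frameLaplacian E g := by
  simp only [frameLaplacian_apply, frameGrad_apply, Derivation.leibniz, map_add, smul_eq_mul,
    Finset.sum_mul, Finset.mul_sum, ← Finset.sum_add_distrib]
  exact Finset.sum_congr rfl fun a _ => by ring

theorem conformalDeriv_pow (u s : A) (w : R) (k : ℕ) :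
    conformalDeriv E u (k * w) (s ^ k) = k * (s ^ (k - 1) * conformalDeriv E u w s) := by
  cases k with
  | zero => simp [conformalDeriv_apply]
  | succ k =>
    simp only [conformalDeriv_apply, Derivation.leibniz_pow, Algebra.smul_def w, map_mul,
      map_natCast, Algebra.smul_def (R := R), Nat.add_sub_cancel, nsmul_eq_mul,
      smul_eq_mul]
    ring

theorem conformalDeriv_of_mul_eq_one {r s : A} (hrs : r * s = 1) (u : A) (w : R) :
    conformalDeriv E u (-w) s = -(s ^ 2 * conformalDeriv E u w r) := by
  have hs : frameGrad E u s = -s ^ 2 • frameGrad E u r :=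
    (frameGrad E u).leibniz_of_mul_eq_one (by rwa [mul_comm])
  rw [conformalDeriv_apply, conformalDeriv_apply, hs, smul_eq_mul]
  simp only [Algebra.smul_def, map_neg]
  linear_combination (algebraMap R A w * u * s) * hrs

section Integration

variable {I : A →ₗ[R] M}

theorem integral_mul_frameLaplacian (hI : ∀ a f, I (E a f) = 0) (f g : A) :
    I (f * frameLaplacian E g) = -I (frameGrad E f g) := by
  have h : f * frameLaplacian E g + frameGrad E f g = ∑ a, E a (f * E a g) := by
    simp only [frameLaplacian_apply, frameGrad_apply, Derivation.leibniz, smul_eq_mul,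
      Finset.mul_sum, ← Finset.sum_add_distrib]
    exact Finset.sum_congr rfl fun a _ => by ring
  rw [eq_neg_iff_add_eq_zero, ← map_add, h, map_sum]
  exact Finset.sum_eq_zero fun a _ => hI a _

theorem integral_frameLaplacian_mul (hI : ∀ a f, I (E a f) = 0) (f g : A) :
    I (frameLaplacian E f * g) = I (f * frameLaplacian E g) := by
  rw [mul_comm, integral_mul_frameLaplacian hI, integral_mul_frameLaplacian hI, frameGrad_comm]

theorem integral_conformalDeriv_mul (hI : ∀ a f, I (E a f) = 0) {u : A} {v w : R}
    (hu : frameLaplacian E u = (v + w) • u) (f g : A) :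
    I (conformalDeriv E u v f * g) = -I (f * conformalDeriv E u w g) := by
  have h := integral_mul_frameLaplacian hI (f * g) u
  rw [hu, frameGrad_comm, eq_neg_iff_add_eq_zero, ← map_add] at h
  rw [eq_neg_iff_add_eq_zero, ← map_add, ← h]
  congr 1
  simp only [conformalDeriv_apply, Derivation.leibniz, Algebra.smul_def, map_add,
    Algebra.algebraMap_self_apply]
  ring

end Integration

end Frame

section SphereFrame

variable {R A : Type*} [CommRing R] [CommRing A] [Algebra R A]

/-- The commutation relations of the left-invariant orthonormal frame of the unit sphere `S³`. The
indices are cyclic, `a + 1` and `a + 2` being taken modulo `3`. -/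
def IsSphereFrame (E : Fin 3 → Derivation R A A) : Prop :=
  ∀ a, ⁅E a, E (a + 1)⁆ = (2 : R) • E (a + 2)

/-- The second order relations satisfied by the restriction to `S³` of a linear function: they
express `Hess u = -u g` in a frame with `IsSphereFrame`. -/
structure IsFirstHarmonic (E : Fin 3 → Derivation R A A) (u : A) : Prop where
  apply_self : ∀ a, E a (E a u) = -u
  apply_succ : ∀ a, E a (E (a + 1) u) = E (a + 2) u

variable {E : Fin 3 → Derivation R A A} {u : A}

theorem IsSphereFrame.apply_apply_succ (hE : IsSphereFrame E) (a : Fin 3) (f : A) :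
    E a (E (a + 1) f) = E (a + 1) (E a f) + 2 * E (a + 2) f := by
  have h := congrArg (fun D : Derivation R A A => D f) (hE a)
  simp only [Derivation.commutator_apply, Derivation.smul_apply, Algebra.smul_def, map_ofNat] at h
  linear_combination h

theorem IsFirstHarmonic.apply_succ_apply (hE : IsSphereFrame E) (hu : IsFirstHarmonic E u)
    (a : Fin 3) : E (a + 1) (E a u) = -E (a + 2) u := by
  linear_combination hu.apply_succ a - hE.apply_apply_succ a u

theorem IsSphereFrame.frameLaplacian_comm (hE : IsSphereFrame E) (a : Fin 3) (f : A) :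
    frameLaplacian E (E a f) = E a (frameLaplacian E f) := by
  have h01 (g) : E 0 (E 1 g) = E 1 (E 0 g) + 2 * E 2 g := hE.apply_apply_succ 0 g
  have h12 (g) : E 1 (E 2 g) = E 2 (E 1 g) + 2 * E 0 g := hE.apply_apply_succ 1 g
  have h20 (g) : E 2 (E 0 g) = E 0 (E 2 g) + 2 * E 1 g := hE.apply_apply_succ 2 g
  have two (b : Fin 3) (g : A) : E b (2 * g) = 2 * E b g := by simp only [two_mul, map_add]
  simp only [frameLaplacian_apply, Fin.sum_univ_three, map_add]
  fin_cases a
  · simp only [Fin.zero_eta, h01, h20, map_add, two]; ring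
  · simp only [Fin.mk_one, h01, h12, map_add, two]; ring
  · simp only [Fin.reduceFinMk, h12, h20, map_add, two]; ring

theorem IsFirstHarmonic.frameLaplacian_eq (hu : IsFirstHarmonic E u) :
    frameLaplacian E u = (-3 : R) • u := by
  simp only [frameLaplacian_apply, hu.apply_self, Fin.sum_univ_three]
  module

theorem IsFirstHarmonic.sum_frameGrad_apply_apply (hE : IsSphereFrame E)
    (hu : IsFirstHarmonic E u) (f : A) :
    ∑ a, frameGrad E (E a u) (E a f) = frameGrad E u f * 2 - u * frameLaplacian E f := by
  have h01 : E 0 (E 1 u) = E 2 u := hu.apply_succ 0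
  have h12 : E 1 (E 2 u) = E 0 u := hu.apply_succ 1
  have h20 : E 2 (E 0 u) = E 1 u := hu.apply_succ 2
  have h10 : E 1 (E 0 u) = -E 2 u := hu.apply_succ_apply hE 0
  have h21 : E 2 (E 1 u) = -E 0 u := hu.apply_succ_apply hE 1
  have h02 : E 0 (E 2 u) = -E 1 u := hu.apply_succ_apply hE 2
  simp only [frameGrad_apply, frameLaplacian_apply, Fin.sum_univ_three, hu.apply_self, h01, h12,
    h20, h10, h21, h02]
  have c01 : E 0 (E 1 f) = E 1 (E 0 f) + 2 * E 2 f := hE.apply_apply_succ 0 f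
  have c12 : E 1 (E 2 f) = E 2 (E 1 f) + 2 * E 0 f := hE.apply_apply_succ 1 f
  have c20 : E 2 (E 0 f) = E 0 (E 2 f) + 2 * E 1 f := hE.apply_apply_succ 2 f
  linear_combination E 2 u * c01 + E 0 u * c12 + E 1 u * c20

theorem IsFirstHarmonic.frameLaplacian_frameGrad (hE : IsSphereFrame E)
    (hu : IsFirstHarmonic E u) (f : A) :
    frameLaplacian E (frameGrad E u f) =
      frameGrad E u (frameLaplacian E f) + frameGrad E u f - 2 * (u * frameLaplacian E f) := by
  have laplacian_apply (a) : frameLaplacian E (E a u) = -(3 * E a u) := by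
    rw [hE.frameLaplacian_comm, hu.frameLaplacian_eq, Derivation.map_smul, Algebra.smul_def,
      map_neg, map_ofNat, neg_mul]
  have laplacian_mul (a) : frameLaplacian E (E a u * E a f) =
      -(3 * E a u) * E a f + 2 * frameGrad E (E a u) (E a f) +
        E a u * E a (frameLaplacian E f) := by
    rw [frameLaplacian_mul, laplacian_apply, hE.frameLaplacian_comm]
  rw [frameGrad_apply u f, map_sum]
  simp only [laplacian_mul, Finset.sum_add_distrib, ← Finset.mul_sum,
    hu.sum_frameGrad_apply_apply hE]
  simp only [neg_mul, mul_assoc, Finset.sum_neg_distrib, ← Finset.mul_sum, ← frameGrad_apply]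
  ring

theorem IsFirstHarmonic.frameLaplacian_add_smul_conformalDeriv (hE : IsSphereFrame E)
    (hu : IsFirstHarmonic E u) (w : R) :
    (frameLaplacian E + (w ^ 2 - 1) • 1) * conformalDeriv E u w =
      conformalDeriv E u (w - 2) * (frameLaplacian E + ((w + 1) ^ 2 - 1) • 1) := by
  ext f
  simp only [Module.End.mul_apply, LinearMap.add_apply, LinearMap.smul_apply, Module.End.one_apply,
    conformalDeriv_apply, map_add, map_smul, hu.frameLaplacian_frameGrad hE,
    frameLaplacian_mul, hu.frameLaplacian_eq]
  simp only [Algebra.smul_def, map_sub, map_add, map_neg, map_pow, map_one, map_ofNat]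
  ring

end SphereFrame

section Paneitz

variable {𝕜 A M : Type*} [Field 𝕜] [CommRing A] [Algebra 𝕜 A]
  [AddCommGroup M] [Module 𝕜 M] {ι : Type*} [Fintype ι]

/-- The Paneitz operator of `S³` in terms of the Laplacian of a frame. -/
def framePaneitz (E : ι → Derivation 𝕜 A A) : Module.End 𝕜 A :=
  frameLaplacian E ^ 2 + (1 / 2 : 𝕜) • frameLaplacian E - (15 / 16 : 𝕜) • 1

theorem framePaneitz_apply (E : ι → Derivation 𝕜 A A) (f : A) :
    framePaneitz E f =
      frameLaplacian E (frameLaplacian E f) + (1 / 2 : 𝕜) • frameLaplacian E f -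
        (15 / 16 : 𝕜) • f := by
  simp [framePaneitz, sq]

theorem integral_framePaneitz_mul {E : ι → Derivation 𝕜 A A}
    {I : A →ₗ[𝕜] M} (hI : ∀ a f, I (E a f) = 0) (f g : A) :
    I (framePaneitz E f * g) = I (f * framePaneitz E g) := by
  simp only [framePaneitz_apply, mul_add, mul_sub, add_mul, sub_mul, mul_smul_comm, smul_mul_assoc,
    map_add, map_sub, map_smul, integral_frameLaplacian_mul hI]

variable [CharZero 𝕜]

theorem framePaneitz_eq_mul (E : ι → Derivation 𝕜 A A) :
    framePaneitz E =
      (frameLaplacian E + (5 / 4 : 𝕜) • 1) * (frameLaplacian E + (-3 / 4 : 𝕜) • 1) := by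
  ext f
  simp only [framePaneitz_apply, Module.End.mul_apply, LinearMap.add_apply, LinearMap.smul_apply,
    Module.End.one_apply, map_add, map_smul]
  module

theorem framePaneitz_eq_mul' (E : ι → Derivation 𝕜 A A) :
    framePaneitz E =
      (frameLaplacian E + (-3 / 4 : 𝕜) • 1) * (frameLaplacian E + (5 / 4 : 𝕜) • 1) := by
  ext f
  simp only [framePaneitz_apply, Module.End.mul_apply, LinearMap.add_apply, LinearMap.smul_apply,
    Module.End.one_apply, map_add, map_smul]
  module

variable {E : Fin 3 → Derivation 𝕜 A A} {u : A} {I : A →ₗ[𝕜] M}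

theorem IsFirstHarmonic.framePaneitz_mul_conformalDeriv (hE : IsSphereFrame E)
    (hu : IsFirstHarmonic E u) :
    framePaneitz E * conformalDeriv E u (1 / 2) =
      conformalDeriv E u (-7 / 2) * framePaneitz E := by
  have h₁ := hu.frameLaplacian_add_smul_conformalDeriv hE (1 / 2 : 𝕜)
  have h₂ := hu.frameLaplacian_add_smul_conformalDeriv hE (-3 / 2 : 𝕜)
  have h₁ : (frameLaplacian E + (-3 / 4 : 𝕜) • 1) * conformalDeriv E u (1 / 2) =
      conformalDeriv E u (-3 / 2) * (frameLaplacian E + (5 / 4 : 𝕜) • 1) := by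
    convert h₁ using 4 <;> norm_num
  have h₂ : (frameLaplacian E + (5 / 4 : 𝕜) • 1) * conformalDeriv E u (-3 / 2) =
      conformalDeriv E u (-7 / 2) * (frameLaplacian E + (-3 / 4 : 𝕜) • 1) := by
    convert h₂ using 4 <;> norm_num
  rw [framePaneitz_eq_mul, mul_assoc, h₁, ← mul_assoc, h₂, mul_assoc, ← framePaneitz_eq_mul',
    framePaneitz_eq_mul]

theorem IsFirstHarmonic.integral_conformalDeriv_mul_framePaneitz (hI : ∀ a f, I (E a f) = 0)
    (hE : IsSphereFrame E) (hu : IsFirstHarmonic E u) (r : A) :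
    I (conformalDeriv E u (1 / 2) r * framePaneitz E r) = 0 := by
  have skew : I (conformalDeriv E u (1 / 2) r * framePaneitz E r) =
      -I (conformalDeriv E u (1 / 2) r * framePaneitz E r) := calc
    _ = -I (r * conformalDeriv E u (-7 / 2) (framePaneitz E r)) :=
      integral_conformalDeriv_mul hI (by rw [hu.frameLaplacian_eq]; norm_num) _ _
    _ = -I (r * framePaneitz E (conformalDeriv E u (1 / 2) r)) := by
      rw [← Module.End.mul_apply, ← hu.framePaneitz_mul_conformalDeriv hE, Module.End.mul_apply]
    _ = -I (conformalDeriv E u (1 / 2) r * framePaneitz E r) := by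
      rw [← integral_framePaneitz_mul hI, mul_comm]
  have two_smul_eq_zero := eq_neg_iff_add_eq_zero.1 skew
  rw [← two_smul 𝕜] at two_smul_eq_zero
  exact (smul_eq_zero.1 two_smul_eq_zero).resolve_left two_ne_zero

theorem IsFirstHarmonic.integral_frameGrad_mul_pow_eq_zero (hI : ∀ a f, I (E a f) = 0)
    (hE : IsSphereFrame E) (hu : IsFirstHarmonic E u) {c r s : A} (hrs : r * s = 1)
    (hP : framePaneitz E r = -(c * s ^ 7)) :
    I (frameGrad E u c * s ^ 6) = 0 := by
  have hs : conformalDeriv E u (-3 : 𝕜) (s ^ 6) =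
      -(6 * (s ^ 7 * conformalDeriv E u (1 / 2 : 𝕜) r)) := calc
    _ = conformalDeriv E u ((6 : ℕ) * -(1 / 2) : 𝕜) (s ^ 6) := by norm_num
    _ = (6 : ℕ) * (s ^ 5 * conformalDeriv E u (-(1 / 2) : 𝕜) s) := conformalDeriv_pow u s _ 6
    _ = -(6 * (s ^ 7 * conformalDeriv E u (1 / 2 : 𝕜) r)) := by
      rw [conformalDeriv_of_mul_eq_one hrs]
      push_cast
      ring
  calc I (frameGrad E u c * s ^ 6) = I (conformalDeriv E u (0 : 𝕜) c * s ^ 6) := by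
        simp [conformalDeriv_apply]
    _ = -I (c * conformalDeriv E u (-3 : 𝕜) (s ^ 6)) :=
        integral_conformalDeriv_mul hI (by rw [hu.frameLaplacian_eq]; norm_num) _ _
    _ = -I ((6 : 𝕜) • (conformalDeriv E u (1 / 2 : 𝕜) r * framePaneitz E r)) := by
        rw [hs, hP, Algebra.smul_def, map_ofNat]
        congr 2
        ring
    _ = 0 := by
        rw [map_smul, hu.integral_conformalDeriv_mul_framePaneitz hI hE, smul_zero, neg_zero]

end Paneitz

open Quaternion MeasureTheory

section LeftInvariantFrame

/-- Right multiplication by a quaternion on `ℝ⁴`, identified with `ℍ` by the coordinates with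
respect to `1, i, j, k`. -/
def rightMul (q : ℍ[ℝ]) : R4 →L[ℝ] R4 :=
  linearIsometryEquivTuple.toContinuousLinearEquiv.toContinuousLinearMap ∘L
    (ContinuousLinearMap.mul ℝ ℍ[ℝ]).flip q ∘L
      linearIsometryEquivTuple.symm.toContinuousLinearEquiv.toContinuousLinearMap

theorem rightMul_apply (q : ℍ[ℝ]) (x : R4) :
    rightMul q x = linearIsometryEquivTuple (linearIsometryEquivTuple.symm x * q) := rfl

theorem rightMul_rightMul (p q : ℍ[ℝ]) (x : R4) :
    rightMul p (rightMul q x) = rightMul (q * p) x := by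
  rw [rightMul_apply, rightMul_apply, rightMul_apply, LinearIsometryEquiv.symm_apply_apply,
    mul_assoc]

theorem rightMul_one (x : R4) : rightMul 1 x = x := by
  rw [rightMul_apply, mul_one, LinearIsometryEquiv.apply_symm_apply]

theorem rightMul_neg (q : ℍ[ℝ]) (x : R4) : rightMul (-q) x = -rightMul q x := by
  rw [rightMul_apply, mul_neg, map_neg, rightMul_apply]

theorem rightMul_add (p q : ℍ[ℝ]) (x : R4) :
    rightMul (p + q) x = rightMul p x + rightMul q x := by
  rw [rightMul_apply, mul_add, map_add, rightMul_apply, rightMul_apply]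

theorem norm_rightMul (q : ℍ[ℝ]) (x : R4) : ‖rightMul q x‖ = ‖x‖ * ‖q‖ := by
  rw [rightMul_apply, LinearIsometryEquiv.norm_map, norm_mul, LinearIsometryEquiv.norm_map]

theorem inner_rightMul_rightMul (p q : ℍ[ℝ]) (x : R4) :
    ⟪rightMul p x, rightMul q x⟫ = ‖x‖ ^ 2 * ⟪p, q⟫ := by
  simp only [real_inner_eq_norm_add_mul_self_sub_norm_mul_self_sub_norm_mul_self_div_two,
    ← rightMul_add, norm_rightMul]
  ring

/-- The imaginary units `i, j, k`. -/
def imUnit (a : Fin 3) : ℍ[ℝ] :=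
  ⟨0, if a = 0 then 1 else 0, if a = 1 then 1 else 0, if a = 2 then 1 else 0⟩

@[simp] theorem re_imUnit (a : Fin 3) : (imUnit a).re = 0 := rfl

@[simp] theorem imI_imUnit (a : Fin 3) : (imUnit a).imI = if a = 0 then 1 else 0 := rfl

@[simp] theorem imJ_imUnit (a : Fin 3) : (imUnit a).imJ = if a = 1 then 1 else 0 := rfl

@[simp] theorem imK_imUnit (a : Fin 3) : (imUnit a).imK = if a = 2 then 1 else 0 := rfl

theorem imUnit_mul_self (a : Fin 3) : imUnit a * imUnit a = -1 := by
  fin_cases a <;> ext <;> simp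

theorem imUnit_mul_succ (a : Fin 3) : imUnit a * imUnit (a + 1) = imUnit (a + 2) := by
  fin_cases a <;> ext <;> simp

theorem imUnit_succ_mul (a : Fin 3) : imUnit (a + 1) * imUnit a = -imUnit (a + 2) := by
  fin_cases a <;> ext <;> simp

theorem inner_imUnit (a b : Fin 3) : ⟪imUnit a, imUnit b⟫ = if a = b then (1 : ℝ) else 0 := by
  rw [Quaternion.inner_def]
  fin_cases a <;> fin_cases b <;> simp

theorem inner_self_rightMul_imUnit (a : Fin 3) (x : R4) : ⟪x, rightMul (imUnit a) x⟫ = 0 := by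
  have h := inner_rightMul_rightMul 1 (imUnit a) x
  rw [rightMul_one, Quaternion.inner_def] at h
  simpa [re_imUnit] using h

theorem rightMul_imUnit_mem_tanPlane (a : Fin 3) (x : S3) : rightMul (imUnit a) x ∈ TanPlane x :=
  Submodule.mem_orthogonal_singleton_iff_inner_right.2 (inner_self_rightMul_imUnit a _)

theorem orthonormal_rightMul_imUnit (x : S3) : Orthonormal ℝ fun a : Fin 3 =>
    (⟨rightMul (imUnit a) x, rightMul_imUnit_mem_tanPlane a x⟩ : TanPlane x) := by
  rw [orthonormal_iff_ite]
  intro a b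
  rw [Submodule.coe_inner, inner_rightMul_rightMul, norm_eq_of_mem_sphere, one_pow, one_mul,
    inner_imUnit]

/-- The left-invariant frame `x i, x j, x k` of `S³`, the group of unit quaternions, as an
orthonormal basis of the tangent space at `x`. -/
def frame (x : S3) : OrthonormalBasis (Fin 3) ℝ (TanPlane x) :=
  OrthonormalBasis.mk (orthonormal_rightMul_imUnit x) <| by
    rw [(orthonormal_rightMul_imUnit x).linearIndependent.span_eq_top_of_card_eq_finrank'
      ((Fintype.card_fin 3).trans (Submodule.finrank_orthogonal_span_singleton (n := 3)
        (ne_zero_of_mem_unit_sphere x)).symm)]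

theorem coe_frame (x : S3) (a : Fin 3) : (frame x a : R4) = rightMul (imUnit a) x := by
  simp [frame]

end LeftInvariantFrame

section Extension

variable {V E : Type*} [NormedAddCommGroup V] [NormedSpace ℝ V] [NormedAddCommGroup E]

theorem contDiffAt_of_contDiffOn_compl_zero [NormedSpace ℝ E] {m : ℕ∞ω} {F : E → V}
    (hF : ContDiffOn ℝ m F {0}ᶜ) (x : Metric.sphere (0 : E) 1) : ContDiffAt ℝ m F x :=
  hF.contDiffAt (isOpen_compl_singleton.mem_nhds (ne_zero_of_mem_unit_sphere x))

variable [InnerProductSpace ℝ E]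

theorem exists_contDiffOn_extension {n : ℕ} [Fact (Module.finrank ℝ E = n + 1)] {m : ℕ∞ω}
    {f : Metric.sphere (0 : E) 1 → V} (hf : ContMDiff (𝓡 n) 𝓘(ℝ, V) m f) :
    ∃ F : E → V, ContDiffOn ℝ m F {0}ᶜ ∧ ∀ x : Metric.sphere (0 : E) 1, F x = f x := by
  let U : TopologicalSpace.Opens E := ⟨{0}ᶜ, isOpen_compl_singleton⟩
  have hproj : ContMDiff 𝓘(ℝ, E) 𝓘(ℝ, E) m fun y : U => ‖(y : E)‖⁻¹ • (y : E) := fun y => by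
    have h : ContMDiffAt 𝓘(ℝ, E) 𝓘(ℝ, E) m (fun z : E => ‖z‖⁻¹ • z) (y : E) :=
      (((contDiffAt_norm ℝ y.2).inv (norm_ne_zero_iff.2 y.2)).smul contDiffAt_id).contMDiffAt
    exact contMDiffAt_subtype_iff.2 h
  have hmem (y : U) : ‖(y : E)‖⁻¹ • (y : E) ∈ Metric.sphere (0 : E) 1 := by
    rw [mem_sphere_zero_iff_norm, norm_smul, norm_inv, norm_norm,
      inv_mul_cancel₀ (norm_ne_zero_iff.2 y.2)]
  have hext (y : U) : Function.extend ((↑) : U → E)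
      (f ∘ Set.codRestrict _ _ hmem) 0 y = f (Set.codRestrict _ _ hmem y) :=
    Subtype.val_injective.extend_apply _ _ y
  refine ⟨Function.extend ((↑) : U → E) (f ∘ Set.codRestrict _ _ hmem) 0, fun y hy => ?_,
    fun x => ?_⟩
  · refine (contMDiffAt_subtype_iff (U := U) (x := ⟨y, hy⟩)).1 ?_ |>.contDiffAt.contDiffWithinAt
    simp only [hext]
    exact hf.comp (hproj.codRestrict_sphere hmem) ⟨y, hy⟩
  · refine (hext ⟨x, ne_zero_of_mem_unit_sphere x⟩).trans (congrArg f (Subtype.ext ?_))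
    simp

theorem contMDiff_comp_coe_sphere {n : ℕ} [Fact (Module.finrank ℝ E = n + 1)] {m : ℕ∞ω}
    {F : E → V} (hF : ContDiffOn ℝ m F {0}ᶜ) :
    ContMDiff (𝓡 n) 𝓘(ℝ, V) m fun x : Metric.sphere (0 : E) 1 => F x :=
  hF.contMDiffOn.comp_contMDiff contMDiff_coe_sphere ne_zero_of_mem_unit_sphere

theorem tanDeriv_apply_of_forall_eq {f : S3 → V} {F : R4 → V} (hf : ∀ x : S3, F x = f x) {x : S3}
    (hF : DifferentiableAt ℝ F x) (w : TanPlane x) : tanDeriv f x w = fderiv ℝ F x w := by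
  obtain rfl : F ∘ (Subtype.val : S3 → R4) = f := funext hf
  have hval : MDifferentiableAt (𝓡 3) 𝓘(ℝ, R4) (Subtype.val : S3 → R4) x :=
    (contMDiff_coe_sphere (m := 1)).mdifferentiableAt one_ne_zero
  have hw : mvfderiv (𝓡 3) (Subtype.val : S3 → R4) x ((tanEquiv x).symm w) = (w : R4) :=
    congrArg Subtype.val ((tanEquiv x).apply_symm_apply w)
  calc tanDeriv (F ∘ Subtype.val) x w
      = mvfderiv (𝓡 3) (F ∘ (Subtype.val : S3 → R4)) x ((tanEquiv x).symm w) := rfl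
    _ = fderiv ℝ F x (mvfderiv (𝓡 3) (Subtype.val : S3 → R4) x ((tanEquiv x).symm w)) := by
      rw [← mfderiv_eq_fderiv]
      exact mfderiv_comp_apply (I' := 𝓘(ℝ, R4)) (x : S3) hF.mdifferentiableAt hval _
    _ = fderiv ℝ F x w := by rw [hw]

end Extension

section FrameDerivation

/-- The algebra `C^∞(S³)`. -/
abbrev SmoothFun : Type := C^∞⟮𝓡 3, S3; 𝓘(ℝ), ℝ⟯

theorem tanDeriv_frame_apply {f : S3 → ℝ} {F : R4 → ℝ} (hF : ContDiffOn ℝ ∞ F {0}ᶜ)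
    (hf : ∀ x : S3, F x = f x) (a : Fin 3) (x : S3) :
    tanDeriv f x (frame x a) = fderiv ℝ F x (rightMul (imUnit a) x) := by
  rw [← coe_frame]
  exact tanDeriv_apply_of_forall_eq hf
    ((contDiffAt_of_contDiffOn_compl_zero hF x).differentiableAt (by simp)) _

theorem contDiffOn_fderiv_rightMul {F : R4 → ℝ} (hF : ContDiffOn ℝ ∞ F {0}ᶜ) (q : ℍ[ℝ]) :
    ContDiffOn ℝ ∞ (fun y => fderiv ℝ F y (rightMul q y)) {0}ᶜ :=
  (hF.fderiv_of_isOpen isOpen_compl_singleton (by simp)).clm_apply (rightMul q).contDiff.contDiffOn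

theorem contMDiff_tanDeriv_frame {f : S3 → ℝ} (hf : ContMDiff (𝓡 3) 𝓘(ℝ) ∞ f) (a : Fin 3) :
    ContMDiff (𝓡 3) 𝓘(ℝ) ∞ fun x => tanDeriv f x (frame x a) := by
  obtain ⟨F, hF, hfF⟩ := exists_contDiffOn_extension hf
  simp only [tanDeriv_frame_apply hF hfF]
  exact contMDiff_comp_coe_sphere (contDiffOn_fderiv_rightMul hF (imUnit a))

theorem tanDeriv_add {f g : S3 → ℝ} {x : S3} (hf : MDifferentiableAt (𝓡 3) 𝓘(ℝ) f x)
    (hg : MDifferentiableAt (𝓡 3) 𝓘(ℝ) g x) :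
    tanDeriv (f + g) x = tanDeriv f x + tanDeriv g x := by
  rw [tanDeriv, mvfderiv_add hf hg]
  rfl

theorem tanDeriv_mul {f g : S3 → ℝ} {x : S3} (hf : MDifferentiableAt (𝓡 3) 𝓘(ℝ) f x)
    (hg : MDifferentiableAt (𝓡 3) 𝓘(ℝ) g x) :
    tanDeriv (f * g) x = f x • tanDeriv g x + g x • tanDeriv f x := by
  rw [tanDeriv, mvfderiv_mul hf hg]
  rfl

theorem tanDeriv_const_smul {f : S3 → ℝ} {x : S3} (hf : MDifferentiableAt (𝓡 3) 𝓘(ℝ) f x)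
    (c : ℝ) : tanDeriv (c • f) x = c • tanDeriv f x := by
  have hc : tanDeriv (fun _ : S3 => c) x = 0 := by
    rw [tanDeriv, mvfderiv_const]
    rfl
  calc tanDeriv (c • f) x = tanDeriv ((fun _ => c) * f) x := rfl
    _ = c • tanDeriv f x := by rw [tanDeriv_mul mdifferentiableAt_const hf, hc, smul_zero, add_zero]

theorem SmoothFun.mdifferentiableAt (f : SmoothFun) (x : S3) :
    MDifferentiableAt (𝓡 3) 𝓘(ℝ) f x :=
  f.contMDiff.mdifferentiable (by simp) x

/-- Differentiation along the left-invariant frame of `S³`. -/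
def frameDerivation (a : Fin 3) : Derivation ℝ SmoothFun SmoothFun :=
  Derivation.mk'
    { toFun := fun f => ⟨fun x => tanDeriv f x (frame x a), contMDiff_tanDeriv_frame f.contMDiff a⟩
      map_add' := fun f g => ContMDiffMap.ext fun x => LinearMap.congr_fun
        (tanDeriv_add (SmoothFun.mdifferentiableAt f x) (SmoothFun.mdifferentiableAt g x)) _
      map_smul' := fun c f => ContMDiffMap.ext fun x => LinearMap.congr_fun
        (tanDeriv_const_smul (SmoothFun.mdifferentiableAt f x) c) _ }
    fun f g => ContMDiffMap.ext fun x => LinearMap.congr_fun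
      (tanDeriv_mul (SmoothFun.mdifferentiableAt f x) (SmoothFun.mdifferentiableAt g x)) _

theorem frameDerivation_apply {f : SmoothFun} {F : R4 → ℝ} (hF : ContDiffOn ℝ ∞ F {0}ᶜ)
    (hf : ∀ x : S3, F x = f x) (a : Fin 3) (x : S3) :
    frameDerivation a f x = fderiv ℝ F x (rightMul (imUnit a) x) :=
  tanDeriv_frame_apply hF hf a x

theorem frameDerivation_frameDerivation_apply {f : SmoothFun} {F : R4 → ℝ}
    (hF : ContDiffOn ℝ ∞ F {0}ᶜ) (hf : ∀ x : S3, F x = f x) (a b : Fin 3) (x : S3) :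
    frameDerivation a (frameDerivation b f) x =
      fderiv ℝ (fderiv ℝ F) x (rightMul (imUnit a) x) (rightMul (imUnit b) x) +
        fderiv ℝ F x (rightMul (imUnit a * imUnit b) x) := by
  have hdiff : DifferentiableAt ℝ (fderiv ℝ F) x :=
    ((contDiffAt_of_contDiffOn_compl_zero hF x).fderiv_right (m := 1)
      (by norm_cast)).differentiableAt one_ne_zero
  rw [frameDerivation_apply (contDiffOn_fderiv_rightMul hF (imUnit b))
    fun y => (frameDerivation_apply hF hf b y).symm,
    (hdiff.hasFDerivAt.clm_apply (rightMul (imUnit b)).hasFDerivAt).fderiv]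
  simp [rightMul_rightMul, add_comm]

theorem isSphereFrame_frameDerivation : IsSphereFrame frameDerivation := by
  intro a
  ext f x
  obtain ⟨F, hF, hfF⟩ := exists_contDiffOn_extension f.contMDiff
  have symm : IsSymmSndFDerivAt ℝ F x :=
    (contDiffAt_of_contDiffOn_compl_zero hF x).isSymmSndFDerivAt <| by
      rw [minSmoothness_of_isRCLikeNormedField]
      exact WithTop.coe_le_coe.2 le_top
  calc ⁅frameDerivation a, frameDerivation (a + 1)⁆ f x
      = frameDerivation a (frameDerivation (a + 1) f) x -
          frameDerivation (a + 1) (frameDerivation a f) x := by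
        rw [Derivation.commutator_apply]; rfl
    _ = 2 * fderiv ℝ F x (rightMul (imUnit (a + 2)) x) := by
        rw [frameDerivation_frameDerivation_apply hF hfF,
          frameDerivation_frameDerivation_apply hF hfF, symm.eq, imUnit_mul_succ, imUnit_succ_mul,
          rightMul_neg, map_neg]
        ring
    _ = 2 * frameDerivation (a + 2) f x := by rw [frameDerivation_apply hF hfF]

/-- The restriction to `S³` of a linear function on `ℝ⁴`. -/
def linearFun (l : R4 →L[ℝ] ℝ) : SmoothFun :=
  ⟨fun x => l x, contMDiff_comp_coe_sphere l.contDiff.contDiffOn⟩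

@[simp] theorem linearFun_apply (l : R4 →L[ℝ] ℝ) (x : S3) : linearFun l x = l x := rfl

theorem frameDerivation_linearFun (a : Fin 3) (l : R4 →L[ℝ] ℝ) :
    frameDerivation a (linearFun l) = linearFun (l ∘L rightMul (imUnit a)) := by
  ext x
  rw [frameDerivation_apply l.contDiff.contDiffOn (fun _ => rfl), l.fderiv]
  rfl

theorem isFirstHarmonic_linearFun (l : R4 →L[ℝ] ℝ) :
    IsFirstHarmonic frameDerivation (linearFun l) where
  apply_self a := by
    ext x
    simp [frameDerivation_linearFun, rightMul_rightMul, imUnit_mul_self, rightMul_neg,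
      rightMul_one]
  apply_succ a := by
    ext x
    simp [frameDerivation_linearFun, rightMul_rightMul, imUnit_mul_succ]

end FrameDerivation

section RoundMetric

theorem inner_grad (f : S3 → ℝ) (x : S3) (w : TanPlane x) : ⟪grad f x, w⟫ = tanDeriv f x w := by
  rw [grad, InnerProductSpace.toDual_symm_apply]
  rfl

theorem SmoothFun.sum_apply {ι : Type*} (s : Finset ι) (f : ι → SmoothFun) (x : S3) :
    (∑ i ∈ s, f i) x = ∑ i ∈ s, f i x := by
  rw [← ContMDiffMap.coeFnAlgHom_apply, map_sum, Finset.sum_apply]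
  rfl

theorem inner_grad_grad (f g : SmoothFun) (x : S3) :
    ⟪grad f x, grad g x⟫ = frameGrad frameDerivation f g x := by
  rw [frameGrad_apply, SmoothFun.sum_apply, ← (frame x).sum_inner_mul_inner]
  refine Finset.sum_congr rfl fun a _ => ?_
  rw [real_inner_comm _ (frame x a : TanPlane x), inner_grad, inner_grad]
  rfl

theorem grad_eq_sum_frame (f : SmoothFun) (x : S3) :
    grad f x = ∑ a, frameDerivation a f x • frame x a := by
  rw [← (frame x).sum_repr' (grad f x)]
  refine Finset.sum_congr rfl fun a _ => ?_
  rw [real_inner_comm, inner_grad]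
  rfl

theorem tanDeriv_sum_smul_frame (g : Fin 3 → SmoothFun) (x : S3) (b : Fin 3) :
    tanDeriv (fun y => ((∑ a, g a y • frame y a : TanPlane y) : R4)) x (frame x b) =
      ∑ a, (g a x • rightMul (imUnit a) (rightMul (imUnit b) x) +
        frameDerivation b (g a) x • rightMul (imUnit a) x) := by
  choose G hG hGg using fun a => exists_contDiffOn_extension (g a).contMDiff
  have hd (a : Fin 3) : HasFDerivAt (G a) (fderiv ℝ (G a) x) x :=
    ((contDiffAt_of_contDiffOn_compl_zero (hG a) x).differentiableAt (by simp)).hasFDerivAt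
  have hsum := HasFDerivAt.fun_sum (u := Finset.univ) fun a _ =>
    (hd a).fun_smul (rightMul (imUnit a)).hasFDerivAt
  rw [tanDeriv_apply_of_forall_eq (F := fun y => ∑ a, G a y • rightMul (imUnit a) y) _
    hsum.differentiableAt, hsum.fderiv]
  · simp [hGg, coe_frame, frameDerivation_apply (hG _) (hGg _)]
  · intro y
    simp [hGg, coe_frame]

theorem divergence_sum_smul_frame (g : Fin 3 → SmoothFun) (x : S3) :
    divergence (fun y => ∑ a, g a y • frame y a) x = ∑ a, frameDerivation a (g a) x := by
  rw [divergence, LinearMap.trace_eq_sum_inner _ (frame x)]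
  refine Finset.sum_congr rfl fun b _ => ?_
  have divergence_free (a : Fin 3) :
      ⟪rightMul (imUnit b) x, rightMul (imUnit a) (rightMul (imUnit b) x)⟫ = 0 :=
    inner_self_rightMul_imUnit a _
  calc ⟪frame x b, covDeriv (fun y => ∑ a, g a y • frame y a) x (frame x b)⟫
      = ⟪rightMul (imUnit b) x,
          tanDeriv (fun y => ((∑ a, g a y • frame y a : TanPlane y) : R4)) x (frame x b)⟫ := by
        rw [← coe_frame]
        exact Submodule.inner_orthogonalProjectionOnto_eq_of_mem_left _ _
    _ = ∑ a, frameDerivation b (g a) x * (if b = a then 1 else 0) := by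
        simp only [tanDeriv_sum_smul_frame, inner_sum, inner_add_right, inner_smul_right,
          divergence_free, inner_rightMul_rightMul, norm_eq_of_mem_sphere, inner_imUnit, mul_zero,
          zero_add, one_pow, one_mul]
    _ = frameDerivation b (g b) x := by simp

theorem laplacian_coe (f : SmoothFun) : laplacian f = frameLaplacian frameDerivation f := by
  ext x
  have hgrad : grad f = fun y => ∑ a, frameDerivation a f y • frame y a :=
    funext (grad_eq_sum_frame f)
  rw [laplacian, hgrad, divergence_sum_smul_frame, frameLaplacian_apply, SmoothFun.sum_apply]

theorem paneitz_coe (f : SmoothFun) : paneitz f = framePaneitz frameDerivation f := by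
  ext x
  rw [paneitz, laplacian_coe, laplacian_coe, framePaneitz_apply]
  rfl

end RoundMetric

section Integration

open scoped Pointwise

variable {E : Type*} [NormedAddCommGroup E] [NormedSpace ℝ E]

/-- The action of a linear isometry on the unit sphere. -/
def sphereMap (φ : E ≃ₗᵢ[ℝ] E) (x : Metric.sphere (0 : E) 1) : Metric.sphere (0 : E) 1 :=
  ⟨φ x, by simp⟩

@[simp] theorem coe_sphereMap (φ : E ≃ₗᵢ[ℝ] E) (x : Metric.sphere (0 : E) 1) :
    (sphereMap φ x : E) = φ x := rfl

theorem continuous_sphereMap (φ : E ≃ₗᵢ[ℝ] E) : Continuous (sphereMap φ) :=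
  (φ.continuous.comp continuous_subtype_val).subtype_mk _

theorem smul_image_sphereMap_preimage (φ : E ≃ₗᵢ[ℝ] E) (I : Set ℝ)
    (s : Set (Metric.sphere (0 : E) 1)) :
    I • ((↑) '' (sphereMap φ ⁻¹' s) : Set E) = φ ⁻¹' (I • ((↑) '' s)) := by
  ext y
  simp only [Set.mem_smul, Set.mem_image, Set.mem_preimage]
  constructor
  · rintro ⟨r, hr, _, ⟨x, hx, rfl⟩, rfl⟩
    exact ⟨r, hr, _, ⟨_, hx, rfl⟩, by simp⟩
  · rintro ⟨r, hr, _, ⟨x, hx, rfl⟩, h⟩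
    have hφx : sphereMap φ (sphereMap φ.symm x) = x := Subtype.ext (by simp)
    refine ⟨r, hr, _, ⟨sphereMap φ.symm x, by rwa [hφx], rfl⟩, φ.injective ?_⟩
    simpa using h

theorem measurePreserving_sphereMap [MeasurableSpace E] [BorelSpace E] {μ : Measure E}
    (φ : E ≃ₗᵢ[ℝ] E) (hφ : MeasurePreserving φ μ μ) :
    MeasurePreserving (sphereMap φ) μ.toSphere μ.toSphere := by
  have hm : Measurable (sphereMap φ) := (continuous_sphereMap φ).measurable
  refine ⟨hm, Measure.ext fun s hs => ?_⟩
  rw [Measure.map_apply hm hs, Measure.toSphere_apply' _ (hm hs), Measure.toSphere_apply' _ hs,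
    smul_image_sphereMap_preimage,
    hφ.measure_preimage_emb φ.toHomeomorph.measurableEmbedding]

/-- Right multiplication by a unit quaternion. -/
def rightMulIsometry (q : ℍ[ℝ]) (hq : ‖q‖ = 1) : R4 ≃ₗᵢ[ℝ] R4 :=
  LinearIsometry.toLinearIsometryEquiv
    { toLinearMap := rightMul q
      norm_map' := fun x => by
        rw [ContinuousLinearMap.coe_coe, norm_rightMul, hq, mul_one] } rfl

/-- The flow of the field `x ↦ x q`, for a purely imaginary quaternion `q`. -/
def rightFlow (q : ℍ[ℝ]) (hq : q.re = 0) (t : ℝ) : R4 ≃ₗᵢ[ℝ] R4 :=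
  rightMulIsometry (NormedSpace.exp (t • q)) (by simp [hq])

theorem rightFlow_apply (q : ℍ[ℝ]) (hq : q.re = 0) (t : ℝ) (x : R4) :
    rightFlow q hq t x = rightMul (NormedSpace.exp (t • q)) x := rfl

theorem hasDerivAt_rightFlow (q : ℍ[ℝ]) (hq : q.re = 0) (t : ℝ) (x : R4) :
    HasDerivAt (fun s => rightFlow q hq s x) (rightMul q (rightFlow q hq t x)) t := by
  simp only [rightFlow_apply, rightMul_rightMul]
  simp only [rightMul_apply]
  exact linearIsometryEquivTuple.toContinuousLinearEquiv.toContinuousLinearMap.hasFDerivAt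
    |>.comp_hasDerivAt t ((hasDerivAt_exp_smul_const q t).const_mul _)

theorem rightFlow_zero (q : ℍ[ℝ]) (hq : q.re = 0) (x : R4) : rightFlow q hq 0 x = x := by
  rw [rightFlow_apply, zero_smul, NormedSpace.exp_zero, rightMul_one]

instance : IsFiniteMeasure surfaceMeasure := by
  unfold surfaceMeasure
  infer_instance

theorem integrable_coe (f : SmoothFun) : Integrable f surfaceMeasure :=
  f.contMDiff.continuous.integrable_of_hasCompactSupport (.of_compactSpace _)

theorem integral_comp_sphereMap (φ : R4 ≃ₗᵢ[ℝ] R4) (f : SmoothFun) :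
    ∫ x, f (sphereMap φ x) ∂surfaceMeasure = ∫ x, f x ∂surfaceMeasure := by
  have h : MeasurePreserving (sphereMap φ) surfaceMeasure surfaceMeasure :=
    measurePreserving_sphereMap φ φ.measurePreserving
  conv_rhs => rw [← h.map_eq]
  exact (integral_map h.aemeasurable f.contMDiff.continuous.aestronglyMeasurable).symm

theorem hasDerivAt_comp_rightFlow (f : SmoothFun) (a : Fin 3) (x : S3) (t : ℝ) :
    HasDerivAt (fun s => f (sphereMap (rightFlow (imUnit a) rfl s) x))
      (frameDerivation a f (sphereMap (rightFlow (imUnit a) rfl t) x)) t := by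
  obtain ⟨F, hF, hfF⟩ := exists_contDiffOn_extension f.contMDiff
  rw [frameDerivation_apply hF hfF]
  simp only [← hfF]
  exact ((contDiffAt_of_contDiffOn_compl_zero hF _).differentiableAt
    (by simp)).hasFDerivAt.comp_hasDerivAt t (hasDerivAt_rightFlow (imUnit a) rfl t x)

theorem integral_frameDerivation (a : Fin 3) (f : SmoothFun) :
    ∫ x, frameDerivation a f x ∂surfaceMeasure = 0 := by
  let ψ (t : ℝ) : S3 → S3 := sphereMap (rightFlow (imUnit a) rfl t)
  have hψ (g : SmoothFun) (t : ℝ) : Continuous fun x => g (ψ t x) :=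
    g.contMDiff.continuous.comp (continuous_sphereMap _)
  obtain ⟨C, hC⟩ := isCompact_univ.exists_bound_of_continuousOn
    (frameDerivation a f).contMDiff.continuous.continuousOn
  have hderiv : HasDerivAt (fun t => ∫ x, f (ψ t x) ∂surfaceMeasure)
      (∫ x, frameDerivation a f (ψ 0 x) ∂surfaceMeasure) 0 :=
    (hasDerivAt_integral_of_dominated_loc_of_deriv_le (bound := fun _ => C) Filter.univ_mem
      (.of_forall fun t => (hψ f t).aestronglyMeasurable)
      ((hψ f 0).integrable_of_hasCompactSupport (.of_compactSpace _))
      (hψ (frameDerivation a f) 0).aestronglyMeasurable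
      (.of_forall fun x t _ => hC (ψ t x) trivial) (integrable_const C)
      (.of_forall fun x t _ => hasDerivAt_comp_rightFlow f a x t)).2
  have hconst (t : ℝ) : ∫ x, f (ψ t x) ∂surfaceMeasure = ∫ x, f x ∂surfaceMeasure :=
    integral_comp_sphereMap _ f
  have hψ_zero (x : S3) : ψ 0 x = x := Subtype.ext (rightFlow_zero _ _ _)
  simp only [hconst, hψ_zero] at hderiv
  exact hderiv.unique (hasDerivAt_const _ _)

/-- Integration over `S³`. -/
def sphereIntegral : SmoothFun →ₗ[ℝ] ℝ where
  toFun f := ∫ x, f x ∂surfaceMeasure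
  map_add' f g := integral_add (integrable_coe f) (integrable_coe g)
  map_smul' c f := integral_const_mul c f

end Integration

end PaneitzSphere

end

open PaneitzSphere MeasureTheory in
theorem corollary5p1_general {χ ρ : S3 → ℝ} (hρ : ContMDiff (𝓡 3) 𝓘(ℝ) ∞ ρ) (hρ0 : ∀ x, ρ x ≠ 0)
    (hP : ∀ x, paneitz ρ x = -(χ x * ρ x ^ (-7 : ℤ))) (l : R4 →L[ℝ] ℝ) :
    ∫ x, ⟪grad χ x, grad (fun y : S3 => l y) x⟫ * ρ x ^ (-6 : ℤ) ∂surfaceMeasure = 0 := by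
  let r : SmoothFun := ⟨ρ, hρ⟩
  let s : SmoothFun := ⟨fun x => (ρ x)⁻¹, fun x => (hρ x).inv₀ (hρ0 x)⟩
  let c : SmoothFun := -(framePaneitz frameDerivation r * r ^ 7)
  have hrs : r * s = 1 := ContMDiffMap.ext fun x => mul_inv_cancel₀ (hρ0 x)
  have hPr : framePaneitz frameDerivation r = -(c * s ^ 7) := by
    linear_combination -(framePaneitz frameDerivation r) * congrArg (· ^ 7) hrs
  have hχ : χ = c := funext fun x => by
    have hx : framePaneitz frameDerivation r x = _ := (congrFun (paneitz_coe r) x).symm.trans (hP x)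
    calc χ x = -(-(χ x * ρ x ^ (-7 : ℤ)) * ρ x ^ 7) := by
          rw [zpow_neg]
          field_simp [hρ0 x]
      _ = c x := by rw [← hx]; rfl
  rw [hχ]
  calc ∫ x, ⟪grad c x, grad (linearFun l) x⟫ * ρ x ^ (-6 : ℤ) ∂surfaceMeasure
      = sphereIntegral (frameGrad frameDerivation (linearFun l) c * s ^ 6) := by
        refine integral_congr_ae (.of_forall fun x => ?_)
        change ⟪grad c x, grad (linearFun l) x⟫ * ρ x ^ (-6 : ℤ) = _
        rw [inner_grad_grad, frameGrad_comm, zpow_neg, ← inv_zpow]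
        rfl
    _ = 0 := (isFirstHarmonic_linearFun l).integral_frameGrad_mul_pow_eq_zero
        integral_frameDerivation isSphereFrame_frameDerivation hrs hPr

theorem corollary5p1 (χ ρ : PaneitzSphere.S3 → ℝ)
    (hχ : ContMDiff (𝓡 3) 𝓘(ℝ, ℝ) ∞ χ) (hρ : ContMDiff (𝓡 3) 𝓘(ℝ, ℝ) ∞ ρ)
    (hχ_pos : ∀ x, 0 < χ x) (hρ_pos : ∀ x, 0 < ρ x)
    (hP : ∀ x, PaneitzSphere.paneitz ρ x = -(χ x * ρ x ^ (-7 : ℤ))) :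
    ∀ i : Fin 4,
      ∫ x, ⟪PaneitzSphere.grad χ x, PaneitzSphere.grad (PaneitzSphere.coord i) x⟫
        * ρ x ^ (-6 : ℤ) ∂PaneitzSphere.surfaceMeasure = 0 := fun i =>
  corollary5p1_general hρ (fun x => (hρ_pos x).ne') hP (EuclideanSpace.proj i)
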